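/- Let $m,n\ge 1$ be integers, let $\mathcal X\subseteq\mathbb R$, and let $X^n$ be a random vector with values in $\mathcal X^n$. Let $A\in\mathbb R^{m\times n}$ be a random matrix, independent of $X^n$, with i.i.d. $\mathcal N(0,1)$ entries, and let $Y^m=AX^n$. Let $\log$ denote the logarithm in base $2$. A lossy compression code of blocklength $n$ and rate $R$ consists of an encoder $f_n:\mathcal X^n\to\{1,\dots,\lfloor 2^{nR}\rfloor\}$ (a measurable map) and a decoder $g_n:\{1,\dots,\lfloor 2^{nR}\rfloor\}\to\mathbb R^n$; its codebook is $\mathcal C_n=\{g_n(f_n(x^n)):x^n\in\mathcal X^n\}$. Suppose that, for some $0<D<1$ and some $\epsilon$, the code achieves distortion $D$ on $X^n$ with excess-distortion probability $\epsilon$, that is, with $\hat X^n=g_n(f_n(X^n))$, $$\mathbb P\Big(\tfrac1n\sum_{i=1}^n (X_i-\hat X_i)^2>D\Big)\le\epsilon .$$ Let $\alpha>0$ and $\eta>1$ be arbitrary, let $$\delta=\frac{\eta}{\log\frac1D}+\alpha,$$ and suppose that the normalized number of observations is $$\frac mn=\frac{2\eta R}{\log\frac1D}.$$ Let $\tilde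 X^n$ be a solution of the compressible signal pursuit (CSP) optimization $$\tilde X^n\in\operatorname*{arg\,min}_{c\in\mathcal C_n}\|Y^m-Ac\|_2^2 ,$$ with ties broken in any way. Then $$\mathbb P\Big(\tfrac1{\sqrt n}\|X^n-\tilde X^n\|_2\ \ge\ \big(2+\sqrt{n/m}\big)\,D^{\frac12\left(1-\frac{1+\delta}{\eta}\right)}\Big)\ \le\ \epsilon+2^{-\frac12 nR\alpha}+e^{-m/2}.$$ -/

import Mathlib

open MeasureTheory ProbabilityTheory

/-- The Euclidean norm of a real vector indexed by `Fin k`. -/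
noncomputable def l2norm {k : ℕ} (v : Fin k → ℝ) : ℝ :=
  ‖(WithLp.toLp 2 v : EuclideanSpace ℝ (Fin k))‖

/-- The per-letter average squared error `(1/n) ∑ (xᵢ - x̂ᵢ)²`. -/
noncomputable def avgDistortion {n : ℕ} (x xhat : Fin n → ℝ) : ℝ :=
  (1 / (n : ℝ)) * ∑ i, (x i - xhat i) ^ 2

/-- A vector of source letters, read as a real vector. -/
def toReal {𝒳 : Set ℝ} {n : ℕ} (x : Fin n → 𝒳) : Fin n → ℝ := fun i => (x i : ℝ)

/-- A fixed-length lossy compression code of blocklength `n` and rate `R` (in bits per letter)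
for sources with alphabet `𝒳 ⊆ ℝ` and real reconstruction alphabet. The index set
`{1, …, 2 ^ (n R)}` is the set of the first `⌊2 ^ (n R)⌋` indices. -/
structure LossyCode (𝒳 : Set ℝ) (n : ℕ) (R : ℝ) where
  /-- the encoder -/
  enc : (Fin n → 𝒳) → Fin ⌊(2 : ℝ) ^ ((n : ℝ) * R)⌋₊
  /-- the encoder is a measurable map -/
  measurable_enc : Measurable enc
  /-- the decoder -/
  dec : Fin ⌊(2 : ℝ) ^ ((n : ℝ) * R)⌋₊ → Fin n → ℝ

namespace LossyCode

variable {𝒳 : Set ℝ} {n : ℕ} {R : ℝ}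

/-- The reconstruction `g(f(x))` of the source block `x`. -/
def reconstruct (C : LossyCode 𝒳 n R) (x : Fin n → 𝒳) : Fin n → ℝ := C.dec (C.enc x)

/-- The codebook `{g(f(x)) : x ∈ 𝒳ⁿ}`. -/
def codebook (C : LossyCode 𝒳 n R) : Set (Fin n → ℝ) := Set.range C.reconstruct

/-- The code achieves distortion `D` on the random block `X` with excess-distortion
probability (at most) `ε`. -/
def AchievesDistortion {Ω : Type*} [MeasurableSpace Ω] (C : LossyCode 𝒳 n R)
    (μ : Measure Ω) (X : Ω → Fin n → 𝒳) (D ε : ℝ) : Prop :=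
  μ.real {ω | D < avgDistortion (toReal (X ω)) (C.reconstruct (X ω))} ≤ ε

end LossyCode

/-- `xt` is a solution of the compressible signal pursuit optimization
`argmin_{c ∈ 𝒞} ‖y - A c‖₂²`. -/
def IsCSPSolution {m n : ℕ} (𝒞 : Set (Fin n → ℝ)) (A : Matrix (Fin m) (Fin n) ℝ)
    (y : Fin m → ℝ) (xt : Fin n → ℝ) : Prop :=
  xt ∈ 𝒞 ∧ ∀ c ∈ 𝒞, l2norm (y - A.mulVec xt) ^ 2 ≤ l2norm (y - A.mulVec c) ^ 2

/-- The entries of the random matrix `A` are independent and standard normal. -/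
def IsIIDStdGaussian {Ω : Type*} [MeasurableSpace Ω] {m n : ℕ} (μ : Measure Ω)
    (A : Ω → Matrix (Fin m) (Fin n) ℝ) : Prop :=
  (∀ i j, HasLaw (fun ω => A ω i j) (gaussianReal 0 1) μ) ∧
    iIndepFun (fun (p : Fin m × Fin n) ω => A ω p.1 p.2) μ

/-!
# Compressible signal pursuit with a Gaussian measurement matrix

Write `w = X - X̂`, where `X̂` is the reconstruction of `X`, and `v = X - c` for a codeword `c`.
Optimality of the CSP solution gives `‖A v‖ ≤ ‖A w‖` for the selected codeword. Outside an event of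
probability at most `ε` one has `‖w‖² ≤ n D`, so an error is only possible if `‖A v‖ ≤ ‖A w‖` for
some codeword with `‖v‖² ≥ K n D`, where `K = 4 D ^ (-(1 + δ) / η)`.

For fixed `w` and `v` the probability of `‖A v‖ ≤ ‖A w‖` is controlled by a Chernoff bound that uses
the *joint* law of `A w` and `A v`. For a standard Gaussian row `a`, the bivariate Gaussian integral
satisfies
`E exp (b (⟪w, a⟫² - ⟪v, a⟫²)) ≤ ((1 - 2 b ‖w‖²) (1 + 2 b ‖v‖²)) ^ (-1/2)`
(`lintegral_exp_inner_sq_sub_inner_sq_le`): the right-hand side is the value for orthogonal `w` and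
`v`, and correlation only decreases the integral. With `b = 1 / (4 n D)` the right-hand side is at
most `2 / √K = D ^ ((1 + δ) / (2 η))`, and the `m` rows are independent
(`measure_l2norm_mulVec_le_of_fixed`). As `A` is independent of `X`, the same bound holds for the
random `w` and `v` (`measure_l2norm_mulVec_le_of_indepFun`).

A union bound over the at most `2 ^ (n R)` codewords (`measureReal_csp_error_le`) and the relation
between `m`, `n` and `R` give the error probability
`ε + 2 ^ (n R) * D ^ (m (1 + δ) / (2 η)) = ε + 2 ^ (-n R δ)`, and `δ ≥ α`
(`rpow_mul_rpow_pow_le`). Comparing `A v` with `A w` directly, instead of bounding the norms of the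
two separately, needs no bound on the largest singular value of `A`; hence neither the summand
`√(n / m)` of the threshold nor the term `exp (-m / 2)` is used.
-/

open scoped NNReal ENNReal

/-! ### Gaussian integrals -/

theorem lintegral_exp_neg_mul_sq_gaussianReal (v : ℝ≥0) (b t : ℝ) (h : 0 < 1 + 2 * b * v) :
    ∫⁻ x, ENNReal.ofReal (Real.exp (-b * (x + t) ^ 2)) ∂gaussianReal 0 v =
      ENNReal.ofReal ((√(1 + 2 * b * v))⁻¹ * Real.exp (-b * t ^ 2 / (1 + 2 * b * v))) := by
  rcases eq_or_ne v 0 with rfl | hv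
  · simp
  set q : ℝ := 1 + 2 * b * v with hq
  have hv' : (0 : ℝ) < v := by positivity
  have hvq : (0 : ℝ) < v / q := by positivity
  have hne : Real.toNNReal (v / q) ≠ 0 := by simpa using hvq
  rw [gaussianReal_of_var_ne_zero _ hv,
    lintegral_withDensity_eq_lintegral_mul _ (measurable_gaussianPDF _ _) (by fun_prop)]
  -- Completing the square: the integrand is a constant multiple of a Gaussian density with
  -- variance `v / q`.
  have key : ∀ x : ℝ, (gaussianPDF 0 v * fun x => ENNReal.ofReal (Real.exp (-b * (x + t) ^ 2))) x
      = ENNReal.ofReal ((√q)⁻¹ * Real.exp (-b * t ^ 2 / q)) *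
        gaussianPDF (-(2 * b * v * t / q)) (Real.toNNReal (v / q)) x := by
    intro x
    simp only [Pi.mul_apply, gaussianPDF, gaussianPDFReal, Real.coe_toNNReal _ hvq.le]
    rw [← ENNReal.ofReal_mul (by positivity), ← ENNReal.ofReal_mul (by positivity)]
    congr 1
    rw [show 2 * Real.pi * (v / q) = 2 * Real.pi * v / q by ring, Real.sqrt_div (by positivity),
      mul_assoc, ← Real.exp_add]
    rw [show (√q)⁻¹ * Real.exp (-b * t ^ 2 / q) * ((√(2 * Real.pi * v) / √q)⁻¹ *
        Real.exp (-(x - -(2 * b * v * t / q)) ^ 2 / (2 * (v / q)))) =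
      (√(2 * Real.pi * v))⁻¹ * (Real.exp (-b * t ^ 2 / q) *
        Real.exp (-(x - -(2 * b * v * t / q)) ^ 2 / (2 * (v / q)))) by
      have : √q ≠ 0 := by positivity
      field_simp, ← Real.exp_add]
    congr 2
    have hq0 : q ≠ 0 := h.ne'
    field_simp
    rw [hq]; ring
  simp_rw [key]
  rw [lintegral_const_mul _ (measurable_gaussianPDF _ _), lintegral_gaussianPDF_eq_one _ hne,
    mul_one]

section StdGaussian

variable {E : Type*} [NormedAddCommGroup E] [InnerProductSpace ℝ E] [FiniteDimensional ℝ E]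
  [MeasurableSpace E] [BorelSpace E]

theorem hasGaussianLaw_inner_prod_stdGaussian (w u : E) :
    HasGaussianLaw (fun a : E => (inner ℝ w a, inner ℝ u a)) (stdGaussian E) :=
  (IsGaussian.hasGaussianLaw_id (μ := stdGaussian E)).map_fun
    ((innerSL ℝ w).prod (innerSL ℝ u))

theorem covariance_inner_stdGaussian (w u : E) :
    cov[fun a => inner ℝ w a, fun a => inner ℝ u a; stdGaussian E] = inner ℝ w u := by
  rw [← covarianceBilin_apply_eq_cov (IsGaussian.memLp_two_id), covarianceBilin_stdGaussian]
  rfl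

theorem map_inner_stdGaussian (w : E) :
    (stdGaussian E).map (fun a => inner ℝ w a) = gaussianReal 0 (‖w‖₊ ^ 2) := by
  have h := (hasGaussianLaw_inner_prod_stdGaussian w w).fst.map_eq_gaussianReal
  have h0 : ∫ a, inner ℝ w a ∂stdGaussian E = 0 := integral_strongDual_stdGaussian (innerSL ℝ w)
  rw [h, h0, ← covariance_self (by fun_prop), covariance_inner_stdGaussian]
  congr
  ext; simp

theorem indepFun_inner_stdGaussian {w u : E} (h : inner ℝ w u = 0) :
    IndepFun (fun a : E => inner ℝ w a) (fun a => inner ℝ u a) (stdGaussian E) :=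
  (hasGaussianLaw_inner_prod_stdGaussian w u).indepFun_of_covariance_eq_zero
    (by rw [covariance_inner_stdGaussian, h])

/-- The exponential moment behind the comparison of `⟪w, a⟫²` with `⟪v, a⟫²`. Splitting
`v = β • w + u` with `u` orthogonal to `w` makes `⟪w, a⟫` and `⟪u, a⟫` independent, and two
one-dimensional Gaussian integrals give the exact value; the bound drops the nonnegative summand
`(2 b ‖w‖²)² β²` of the determinant. -/
theorem lintegral_exp_inner_sq_sub_inner_sq_le (w v : E) {b : ℝ} (hb : 0 ≤ b)
    (hw : 2 * b * ‖w‖ ^ 2 < 1) :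
    ∫⁻ a, ENNReal.ofReal (Real.exp (b * (inner ℝ w a ^ 2 - inner ℝ v a ^ 2))) ∂stdGaussian E ≤
      ENNReal.ofReal (√((1 - 2 * b * ‖w‖ ^ 2) * (1 + 2 * b * ‖v‖ ^ 2)))⁻¹ := by
  -- If `w = 0`, the division by zero gives `β = 0` and `u = v`, as it should.
  set β : ℝ := inner ℝ w v / ‖w‖ ^ 2 with hβ
  set u : E := v - β • w with hu
  have huw : inner ℝ w u = 0 := by
    rw [hu, inner_sub_right, inner_smul_right, real_inner_self_eq_norm_sq, hβ]
    rcases eq_or_ne w 0 with rfl | h0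
    · simp
    · field_simp
      simp
  have hv : v = β • w + u := by simp [hu]
  have hvn : ‖v‖ ^ 2 = β ^ 2 * ‖w‖ ^ 2 + ‖u‖ ^ 2 := by
    rw [hv, norm_add_sq_real, inner_smul_left, huw, norm_smul]
    simp [mul_pow]
  set q : ℝ := 1 + 2 * b * ‖u‖ ^ 2 with hq
  have hq0 : 0 < q := by positivity
  have hp : (stdGaussian E).map (fun a => (inner ℝ w a, inner ℝ u a)) =
      (gaussianReal 0 (‖w‖₊ ^ 2)).prod (gaussianReal 0 (‖u‖₊ ^ 2)) := by
    rw [(indepFun_iff_map_prod_eq_prod_map_map (by fun_prop) (by fun_prop)).1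
      (indepFun_inner_stdGaussian huw), map_inner_stdGaussian, map_inner_stdGaussian]
  -- Integrating out `⟪u, a⟫` leaves `exp (-c ⟪w, a⟫²)`, up to the factor `(√q)⁻¹`.
  set c : ℝ := -b + b * β ^ 2 / q with hc
  have hdet : (1 + 2 * c * ‖w‖ ^ 2) * q =
      (1 - 2 * b * ‖w‖ ^ 2) * (1 + 2 * b * ‖v‖ ^ 2) + (2 * b * ‖w‖ ^ 2) ^ 2 * β ^ 2 := by
    rw [hc, hvn]; field_simp; rw [hq]; ring
  have hpos : 0 < (1 - 2 * b * ‖w‖ ^ 2) * (1 + 2 * b * ‖v‖ ^ 2) :=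
    mul_pos (by linarith) (by positivity)
  have hcq : 0 < 1 + 2 * c * ‖w‖ ^ 2 := by
    refine pos_of_mul_pos_left (b := q) ?_ hq0.le
    rw [hdet]; positivity
  let F : ℝ × ℝ → ℝ≥0∞ := fun p => ENNReal.ofReal (Real.exp (b * p.1 ^ 2)) *
    ENNReal.ofReal (Real.exp (-b * (p.2 + β * p.1) ^ 2))
  have hF : Measurable F := by fun_prop
  calc ∫⁻ a, ENNReal.ofReal (Real.exp (b * (inner ℝ w a ^ 2 - inner ℝ v a ^ 2))) ∂stdGaussian E
      = ∫⁻ a, F (inner ℝ w a, inner ℝ u a) ∂stdGaussian E := by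
        refine lintegral_congr fun a => ?_
        dsimp only [F]
        rw [← ENNReal.ofReal_mul (by positivity), ← Real.exp_add]
        nth_rw 1 [hv]
        rw [inner_add_left, inner_smul_left]
        simp only [conj_trivial]
        ring_nf
    _ = ∫⁻ x, ∫⁻ y, ENNReal.ofReal (Real.exp (b * x ^ 2)) *
          ENNReal.ofReal (Real.exp (-b * (y + β * x) ^ 2)) ∂gaussianReal 0 (‖u‖₊ ^ 2)
          ∂gaussianReal 0 (‖w‖₊ ^ 2) := by
        rw [← lintegral_map (f := F) (g := fun a : E => (inner ℝ w a, inner ℝ u a)) hF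
          (by fun_prop), hp, lintegral_prod _ hF.aemeasurable]
    _ = ∫⁻ x, ENNReal.ofReal (√q)⁻¹ * ENNReal.ofReal (Real.exp (-c * (x + 0) ^ 2))
          ∂gaussianReal 0 (‖w‖₊ ^ 2) := by
        refine lintegral_congr fun x => ?_
        rw [lintegral_const_mul _ (by fun_prop), lintegral_exp_neg_mul_sq_gaussianReal _ _ _
          (by push_cast; exact hq0)]
        push_cast
        rw [← hq, ENNReal.ofReal_mul (by positivity), mul_left_comm,
          ← ENNReal.ofReal_mul (by positivity), ← Real.exp_add, hc]
        congr 3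
        ring
    _ = ENNReal.ofReal (√((1 + 2 * c * ‖w‖ ^ 2) * q))⁻¹ := by
        rw [lintegral_const_mul _ (by fun_prop), lintegral_exp_neg_mul_sq_gaussianReal _ _ _
          (by push_cast; exact hcq)]
        push_cast
        rw [← ENNReal.ofReal_mul (by positivity), Real.sqrt_mul hcq.le, mul_inv_rev]
        simp
    _ ≤ _ := by
        refine ENNReal.ofReal_le_ofReal (inv_anti₀ (Real.sqrt_pos.2 hpos) (Real.sqrt_le_sqrt ?_))
        rw [hdet]
        exact le_add_of_nonneg_right (by positivity)

end StdGaussian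

/-! ### Random matrices with independent entries -/

/-- The rows of a matrix with i.i.d. entries are i.i.d. random vectors. -/
theorem lintegral_prod_rows {ι κ : Type*} [Fintype ι] [Fintype κ] (γ : Measure ℝ)
    [IsProbabilityMeasure γ] {f : (κ → ℝ) → ℝ≥0∞} (hf : Measurable f) :
    ∫⁻ a, ∏ i, f (fun j => a (i, j)) ∂Measure.pi (fun _ : ι × κ => γ) =
      (∫⁻ r, f r ∂Measure.pi (fun _ : κ => γ)) ^ Fintype.card ι := by
  have hind := iIndepFun_uncurry_infinitePi' (X := fun (_ : ι) (_ : κ) (x : ℝ) => x)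
    (fun _ _ => γ) (fun _ _ => measurable_id)
  simp only [Measure.infinitePi_eq_pi] at hind
  have hmap := hind.map_fun_eq_pi_map (fun p =>
    ((measurable_pi_apply p.2).comp (measurable_pi_apply p.1)).aemeasurable)
  have hcell : ∀ p : ι × κ, (Measure.pi fun _ : ι => Measure.pi fun _ : κ => γ).map
      (fun a => a p.1 p.2) = γ := fun p =>
    ((measurePreserving_eval (fun _ : κ => γ) p.2).comp
      (measurePreserving_eval (fun _ : ι => Measure.pi fun _ : κ => γ) p.1)).map_eq
  simp only [hcell] at hmap
  rw [← hmap, lintegral_map (by fun_prop) (by fun_prop)]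
  rw [lintegral_prod_eq_prod_lintegral_of_indepFun Finset.univ
    (fun i (a : ι → κ → ℝ) => f (a i)) (iIndepFun_pi fun _ => hf.aemeasurable)
    (fun i => hf.comp (measurable_pi_apply i))]
  simp_rw [(measurePreserving_eval (fun _ : ι => Measure.pi fun _ : κ => γ) _).lintegral_comp hf]
  simp

/-! ### Comparing the images of two vectors under a Gaussian matrix -/

theorem l2norm_mulVec_sq {m n : ℕ} (A : Matrix (Fin m) (Fin n) ℝ) (v : Fin n → ℝ) :
    l2norm (A.mulVec v) ^ 2 =
      ∑ i, inner ℝ (WithLp.toLp 2 v : EuclideanSpace ℝ (Fin n)) (WithLp.toLp 2 (A i)) ^ 2 := by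
  simp [l2norm, EuclideanSpace.real_norm_sq_eq, Matrix.mulVec, PiLp.inner_apply, dotProduct]

theorem Measurable.l2norm_mulVec_sq {S : Type*} [MeasurableSpace S] {m n : ℕ}
    {u : S → Fin n → ℝ} (hu : Measurable u) :
    Measurable fun p : S × (Fin m × Fin n → ℝ) =>
      l2norm ((Matrix.of fun i j => p.2 (i, j)).mulVec (u p.1)) ^ 2 := by
  have hu' : ∀ j, Measurable fun p : S × (Fin m × Fin n → ℝ) => u p.1 j :=
    fun j => (measurable_pi_apply j).comp (hu.comp measurable_fst)
  simp only [l2norm, EuclideanSpace.real_norm_sq_eq, Matrix.mulVec, dotProduct, Matrix.of_apply]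
  fun_prop

theorem measurable_l2norm_sq {n : ℕ} : Measurable fun v : Fin n → ℝ => l2norm v ^ 2 := by
  simp only [l2norm, EuclideanSpace.real_norm_sq_eq]
  fun_prop

/-- Chernoff bound: for fixed vectors with `‖v‖² ≥ K Δ ≥ K ‖w‖²`, a standard Gaussian matrix, given
by its family of entries, maps `v` to a vector no longer than the image of `w` with probability at
most `(4 / K) ^ (m / 2)`. -/
theorem measure_l2norm_mulVec_le_of_fixed {m n : ℕ} (w v : Fin n → ℝ) {Δ K : ℝ} (hΔ : 0 < Δ)
    (hK : 0 < K) (hw : l2norm w ^ 2 ≤ Δ) (hv : K * Δ ≤ l2norm v ^ 2) :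
    Measure.pi (fun _ : Fin m × Fin n => gaussianReal 0 1)
      {a | l2norm ((Matrix.of fun i j => a (i, j)).mulVec v) ^ 2 ≤
        l2norm ((Matrix.of fun i j => a (i, j)).mulVec w) ^ 2} ≤
      ENNReal.ofReal ((2 / √K) ^ m) := by
  set w' : EuclideanSpace ℝ (Fin n) := WithLp.toLp 2 w with hw'
  set v' : EuclideanSpace ℝ (Fin n) := WithLp.toLp 2 v with hv'
  -- This value makes `1 - 2 b ‖w‖² ≥ 1 / 2` and `1 + 2 b ‖v‖² ≥ K / 2`.
  set b : ℝ := 1 / (4 * Δ) with hb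
  have hb0 : 0 < b := by positivity
  let g : EuclideanSpace ℝ (Fin n) → ℝ≥0∞ := fun r =>
    ENNReal.ofReal (Real.exp (b * (inner ℝ w' r ^ 2 - inner ℝ v' r ^ 2)))
  have hg : Measurable g := by fun_prop
  let f : (Fin n → ℝ) → ℝ≥0∞ := fun r => g (WithLp.toLp 2 r)
  have hf : Measurable f := hg.comp (WithLp.measurable_toLp 2 _)
  have hfm : Measurable fun a : Fin m × Fin n → ℝ => ∏ i, f (fun j => a (i, j)) :=
    Finset.measurable_prod _ fun i _ =>
      hf.comp (measurable_pi_lambda _ fun j => measurable_pi_apply (i, j))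
  have hbw : 2 * b * ‖w'‖ ^ 2 ≤ 1 / 2 := by
    calc 2 * b * ‖w'‖ ^ 2 ≤ 2 * b * Δ := by gcongr; exact hw
      _ = 1 / 2 := by rw [hb]; field_simp; norm_num
  have hbv : K / 2 ≤ 2 * b * ‖v'‖ ^ 2 := by
    calc K / 2 = 2 * b * (K * Δ) := by rw [hb]; field_simp; norm_num
      _ ≤ _ := by gcongr; exact hv
  have hdet : K / 4 ≤ (1 - 2 * b * ‖w'‖ ^ 2) * (1 + 2 * b * ‖v'‖ ^ 2) := by
    calc K / 4 ≤ (1 / 2) * (1 + K / 2) := by linarith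
      _ ≤ _ := mul_le_mul (by linarith) (by linarith) (by positivity) (by linarith)
  have hrow : ∫⁻ r, f r ∂Measure.pi (fun _ : Fin n => gaussianReal 0 1) ≤
      ENNReal.ofReal (2 / √K) := by
    have h := lintegral_exp_inner_sq_sub_inner_sq_le w' v' hb0.le (hbw.trans_lt (by norm_num))
    rw [← map_pi_eq_stdGaussian, lintegral_map hg (WithLp.measurable_toLp 2 _)] at h
    refine h.trans (ENNReal.ofReal_le_ofReal ?_)
    calc _ ≤ (√(K / 4))⁻¹ :=
          inv_anti₀ (Real.sqrt_pos.2 (by positivity)) (Real.sqrt_le_sqrt hdet)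
      _ = 2 / √K := by
          rw [Real.sqrt_div hK.le, show (4 : ℝ) = 2 ^ 2 by norm_num, Real.sqrt_sq (by norm_num),
            inv_div]
  have hprod : ∀ a : Fin m × Fin n → ℝ, ∏ i, f (fun j => a (i, j)) = ENNReal.ofReal (Real.exp
      (b * (l2norm ((Matrix.of fun i j => a (i, j)).mulVec w) ^ 2 -
        l2norm ((Matrix.of fun i j => a (i, j)).mulVec v) ^ 2))) := by
    intro a
    rw [l2norm_mulVec_sq, l2norm_mulVec_sq, ← Finset.sum_sub_distrib, Finset.mul_sum,
      Real.exp_sum, ENNReal.ofReal_prod_of_nonneg (fun _ _ => (Real.exp_pos _).le)]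
    rfl
  calc _ ≤ Measure.pi (fun _ : Fin m × Fin n => gaussianReal 0 1)
        {a | 1 ≤ ∏ i, f (fun j => a (i, j))} := by
        refine measure_mono fun a ha => ?_
        rw [Set.mem_ofPred_eq] at ha ⊢
        rw [hprod, ENNReal.one_le_ofReal, Real.one_le_exp_iff]
        exact mul_nonneg hb0.le (sub_nonneg.2 ha)
    _ ≤ ∫⁻ a, ∏ i, f (fun j => a (i, j))
          ∂Measure.pi (fun _ : Fin m × Fin n => gaussianReal 0 1) := by
        simpa using mul_meas_ge_le_lintegral₀ (ε := 1)
          (μ := Measure.pi (fun _ : Fin m × Fin n => gaussianReal 0 1))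
          (f := fun a => ∏ i, f (fun j => a (i, j))) hfm.aemeasurable
    _ = (∫⁻ r, f r ∂Measure.pi (fun _ : Fin n => gaussianReal 0 1)) ^ m := by
        rw [lintegral_prod_rows _ hf, Fintype.card_fin]
    _ ≤ ENNReal.ofReal (2 / √K) ^ m := by gcongr
    _ = _ := (ENNReal.ofReal_pow (by positivity) m).symm

/-- The bound of `measure_l2norm_mulVec_le_of_fixed` for random `w` and `v` that are functions of
a variable independent of the matrix, by Fubini. -/
theorem measure_l2norm_mulVec_le_of_indepFun {Ω S : Type*} [MeasurableSpace Ω] [MeasurableSpace S]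
    {μ : Measure Ω} [IsProbabilityMeasure μ] {m n : ℕ} {A : Ω → Matrix (Fin m) (Fin n) ℝ}
    (hA : IsIIDStdGaussian μ A) {X : Ω → S} (hX : Measurable X)
    (hXA : IndepFun X (fun ω (p : Fin m × Fin n) => A ω p.1 p.2) μ)
    {w v : S → Fin n → ℝ} (hwm : Measurable w) (hvm : Measurable v) {Δ K : ℝ}
    (hΔ : 0 < Δ) (hK : 0 < K) :
    μ {ω | l2norm (w (X ω)) ^ 2 ≤ Δ ∧ K * Δ ≤ l2norm (v (X ω)) ^ 2 ∧
        l2norm ((A ω).mulVec (v (X ω))) ^ 2 ≤ l2norm ((A ω).mulVec (w (X ω))) ^ 2} ≤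
      ENNReal.ofReal ((2 / √K) ^ m) := by
  have hcell : ∀ p : Fin m × Fin n, AEMeasurable (fun ω => A ω p.1 p.2) μ :=
    fun p => (hA.1 p.1 p.2).aemeasurable
  have hAm : AEMeasurable (fun ω (p : Fin m × Fin n) => A ω p.1 p.2) μ :=
    aemeasurable_pi_lambda _ hcell
  have hlaw : μ.map (fun ω (p : Fin m × Fin n) => A ω p.1 p.2) =
      Measure.pi fun _ => gaussianReal 0 1 := by
    rw [hA.2.map_fun_eq_pi_map hcell]
    congr with p : 1
    exact (hA.1 p.1 p.2).map_eq
  have hjoint := (indepFun_iff_map_prod_eq_prod_map_map hX.aemeasurable hAm).1 hXA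
  rw [hlaw] at hjoint
  have := Measure.isProbabilityMeasure_map (μ := μ) hX.aemeasurable
  set s : Set (S × (Fin m × Fin n → ℝ)) := {p | l2norm (w p.1) ^ 2 ≤ Δ ∧
    K * Δ ≤ l2norm (v p.1) ^ 2 ∧
    l2norm ((Matrix.of fun i j => p.2 (i, j)).mulVec (v p.1)) ^ 2 ≤
      l2norm ((Matrix.of fun i j => p.2 (i, j)).mulVec (w p.1)) ^ 2} with hs
  have hsm : MeasurableSet s := by
    have h1 : Measurable fun p : S × (Fin m × Fin n → ℝ) => l2norm (w p.1) ^ 2 :=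
      measurable_l2norm_sq.comp (hwm.comp measurable_fst)
    have h2 : Measurable fun p : S × (Fin m × Fin n → ℝ) => l2norm (v p.1) ^ 2 :=
      measurable_l2norm_sq.comp (hvm.comp measurable_fst)
    have h3 := measurableSet_le (hvm.l2norm_mulVec_sq (m := m)) (hwm.l2norm_mulVec_sq (m := m))
    exact (measurableSet_le h1 measurable_const).inter
      ((measurableSet_le measurable_const h2).inter h3)
  calc μ ((fun ω => (X ω, fun p : Fin m × Fin n => A ω p.1 p.2)) ⁻¹' s)
      = μ.map (fun ω => (X ω, fun p : Fin m × Fin n => A ω p.1 p.2)) s :=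
        (Measure.map_apply_of_aemeasurable (hX.aemeasurable.prodMk hAm) hsm).symm
    _ = ∫⁻ x, Measure.pi (fun _ => gaussianReal 0 1) (Prod.mk x ⁻¹' s) ∂μ.map X := by
        rw [hjoint, Measure.prod_apply hsm]
    _ ≤ ∫⁻ _, ENNReal.ofReal ((2 / √K) ^ m) ∂μ.map X := by
        refine lintegral_mono fun x => ?_
        by_cases hx : l2norm (w x) ^ 2 ≤ Δ ∧ K * Δ ≤ l2norm (v x) ^ 2
        · exact (measure_mono fun a ha => ha.2.2).trans
            (measure_l2norm_mulVec_le_of_fixed (w x) (v x) hΔ hK hx.1 hx.2)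
        · have : Prod.mk x ⁻¹' s = ∅ :=
            Set.eq_empty_of_forall_notMem fun a ha => hx ⟨ha.1, ha.2.1⟩
          simp [this]
    _ = _ := by simp

/-! ### Error probability of compressible signal pursuit -/

theorem avgDistortion_eq {n : ℕ} (x y : Fin n → ℝ) :
    avgDistortion x y = (1 / (n : ℝ)) * l2norm (x - y) ^ 2 := by
  simp [avgDistortion, l2norm, EuclideanSpace.real_norm_sq_eq]

theorem LossyCode.measurable_reconstruct {𝒳 : Set ℝ} {n : ℕ} {R : ℝ} (C : LossyCode 𝒳 n R) :
    Measurable C.reconstruct :=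
  (measurable_of_countable C.dec).comp C.measurable_enc

theorem measurable_toReal {𝒳 : Set ℝ} {n : ℕ} :
    Measurable (toReal : (Fin n → 𝒳) → Fin n → ℝ) :=
  measurable_pi_lambda _ fun i => measurable_subtype_coe.comp (measurable_pi_apply i)

/-- The defining inequality of CSP, compared with the reconstruction of the source block itself. The
competitor is named by an index `k`, so that a union bound can run over a fixed finite type. -/
theorem IsCSPSolution.exists_l2norm_mulVec_le {𝒳 : Set ℝ} {m n : ℕ} {R : ℝ}
    {C : LossyCode 𝒳 n R} {A : Matrix (Fin m) (Fin n) ℝ} {x : Fin n → 𝒳} {xt : Fin n → ℝ}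
    (h : IsCSPSolution C.codebook A (A.mulVec (toReal x)) xt) :
    ∃ k, xt = C.dec k ∧ l2norm (A.mulVec (toReal x - C.dec k)) ^ 2 ≤
      l2norm (A.mulVec (toReal x - C.reconstruct x)) ^ 2 := by
  obtain ⟨⟨x', rfl⟩, hmin⟩ := h
  refine ⟨C.enc x', rfl, ?_⟩
  rw [Matrix.mulVec_sub, Matrix.mulVec_sub]
  exact hmin _ ⟨x, rfl⟩

/-- Union bound over the codewords: the squared CSP error exceeds `K` times the admissible squared
distortion `n D` with probability at most `ε + 2 ^ (n R) (4 / K) ^ (m / 2)`. -/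
theorem measureReal_csp_error_le {Ω : Type*} [MeasurableSpace Ω] {μ : Measure Ω}
    [IsProbabilityMeasure μ] {m n : ℕ} (hn : 0 < n)
    {𝒳 : Set ℝ} {X : Ω → Fin n → 𝒳} (hX : Measurable X)
    {A : Ω → Matrix (Fin m) (Fin n) ℝ} (hA : IsIIDStdGaussian μ A)
    (hXA : IndepFun X (fun ω (p : Fin m × Fin n) => A ω p.1 p.2) μ)
    {R D ε : ℝ} (hD0 : 0 < D) {C : LossyCode 𝒳 n R} (hC : C.AchievesDistortion μ X D ε)
    {Xt : Ω → Fin n → ℝ}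
    (hXt : ∀ᵐ ω ∂μ, IsCSPSolution C.codebook (A ω) ((A ω).mulVec (toReal (X ω))) (Xt ω))
    {K : ℝ} (hK : 0 < K) :
    μ.real {ω | K * (n * D) ≤ l2norm (toReal (X ω) - Xt ω) ^ 2} ≤
      ε + (2 : ℝ) ^ ((n : ℝ) * R) * (2 / √K) ^ m := by
  have hn' : (0 : ℝ) < n := by exact_mod_cast hn
  set E : Set Ω := {ω | D < avgDistortion (toReal (X ω)) (C.reconstruct (X ω))} with hE
  let B : Fin ⌊(2 : ℝ) ^ ((n : ℝ) * R)⌋₊ → Set Ω := fun k =>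
    {ω | l2norm (toReal (X ω) - C.reconstruct (X ω)) ^ 2 ≤ n * D ∧
      K * (n * D) ≤ l2norm (toReal (X ω) - C.dec k) ^ 2 ∧
      l2norm ((A ω).mulVec (toReal (X ω) - C.dec k)) ^ 2 ≤
        l2norm ((A ω).mulVec (toReal (X ω) - C.reconstruct (X ω))) ^ 2}
  have hB : ∀ k, μ.real (B k) ≤ (2 / √K) ^ m := fun k =>
    ENNReal.toReal_le_of_le_ofReal (by positivity)
      (measure_l2norm_mulVec_le_of_indepFun hA hX hXA
        (w := fun x => toReal x - C.reconstruct x) (v := fun x => toReal x - C.dec k)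
        (measurable_toReal.sub C.measurable_reconstruct) (measurable_toReal.sub_const _)
        (by positivity) hK)
  have hsub : {ω | K * (n * D) ≤ l2norm (toReal (X ω) - Xt ω) ^ 2}
      ≤ᵐ[μ] (E ∪ ⋃ k, B k : Set Ω) := by
    filter_upwards [hXt] with ω hω hfar
    by_cases hEω : ω ∈ E
    · exact Or.inl hEω
    obtain ⟨k, hk, hle⟩ := hω.exists_l2norm_mulVec_le
    refine Or.inr (Set.mem_iUnion.2 ⟨k, ?_, hk ▸ hfar, hle⟩)
    rw [hE, Set.mem_ofPred_eq, not_lt, avgDistortion_eq, one_div, inv_mul_le_iff₀ hn'] at hEω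
    exact hEω
  calc _ ≤ μ.real (E ∪ ⋃ k, B k) := ENNReal.toReal_mono (measure_ne_top _ _) (measure_mono_ae hsub)
    _ ≤ μ.real E + μ.real (⋃ k, B k) := measureReal_union_le _ _
    _ ≤ ε + ∑ k, μ.real (B k) := by
        gcongr
        · exact hC
        · exact measureReal_iUnion_fintype_le _
    _ ≤ ε + ∑ _k : Fin ⌊(2 : ℝ) ^ ((n : ℝ) * R)⌋₊, (2 / √K) ^ m := by
        gcongr with k
        exact hB k
    _ ≤ _ := by
        rw [Finset.sum_const, Finset.card_univ, Fintype.card_fin, nsmul_eq_mul]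
        gcongr
        exact Nat.floor_le (by positivity)

/-- The choice of `m` turns the left-hand side into `2 ^ (-n R δ)`. Positivity of `R`, needed for
the comparison with `δ ≥ α`, follows from `m > 0`. -/
theorem rpow_mul_rpow_pow_le {m n : ℕ} (hm : 0 < m) (hn : 0 < n) {R D α η δ : ℝ} (hD0 : 0 < D)
    (hD1 : D < 1) (hα : 0 < α) (hη : 1 < η) (hδ : δ = η / Real.logb 2 (1 / D) + α)
    (hmn : (m : ℝ) / n = 2 * η * R / Real.logb 2 (1 / D)) :
    (2 : ℝ) ^ ((n : ℝ) * R) * (D ^ ((1 + δ) / η / 2)) ^ m ≤ 2 ^ (-(1 / 2 : ℝ) * n * R * α) := by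
  have hn' : (0 : ℝ) < n := by exact_mod_cast hn
  have hm' : (0 : ℝ) < m := by exact_mod_cast hm
  have hη0 : 0 < η := by linarith
  set L := Real.logb 2 (1 / D) with hL
  have hL0 : 0 < L := Real.logb_pos (by norm_num) (by rwa [one_lt_div hD0])
  have hmL : (m : ℝ) * L = 2 * η * R * n := by field_simp at hmn; linarith
  have hR : 0 < R := by
    have : 0 < R * (2 * η * n) := by nlinarith [mul_pos hm' hL0]
    exact pos_of_mul_pos_left this (by positivity)
  have hD : D = (2 : ℝ) ^ (-L) := by
    rw [hL, one_div, Real.logb_inv, neg_neg, Real.rpow_logb (by norm_num) (by norm_num) hD0]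
  have hδα : α ≤ δ := by rw [hδ]; exact le_add_of_nonneg_left (by positivity)
  rw [hD, ← Real.rpow_mul (by norm_num), ← Real.rpow_natCast, ← Real.rpow_mul (by norm_num),
    ← Real.rpow_add (by norm_num)]
  refine Real.rpow_le_rpow_of_exponent_le (by norm_num) ?_
  have hexp : -L * ((1 + δ) / η / 2) * m = -((1 + δ) * (n * R)) := by
    calc _ = -((m * L) * (1 + δ) / η / 2) := by ring
      _ = _ := by rw [hmL]; field_simp
  have hnR : 0 < n * R := by positivity
  rw [hexp]
  nlinarith [mul_le_mul_of_nonneg_left hδα hnR.le, mul_pos hnR hα]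

theorem theorem1 {Ω : Type*} [MeasurableSpace Ω] (μ : Measure Ω) [IsProbabilityMeasure μ]
    (m n : ℕ) (hm : 0 < m) (hn : 0 < n)
    (𝒳 : Set ℝ) (X : Ω → Fin n → 𝒳) (hX : Measurable X)
    (A : Ω → Matrix (Fin m) (Fin n) ℝ) (hA : IsIIDStdGaussian μ A)
    (hXA : IndepFun X (fun ω (p : Fin m × Fin n) => A ω p.1 p.2) μ)
    (R D ε : ℝ) (hD0 : 0 < D) (hD1 : D < 1)
    (C : LossyCode 𝒳 n R) (hC : C.AchievesDistortion μ X D ε)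
    (α η δ : ℝ) (hα : 0 < α) (hη : 1 < η)
    (hδ : δ = η / Real.logb 2 (1 / D) + α)
    (hmn : (m : ℝ) / (n : ℝ) = 2 * η * R / Real.logb 2 (1 / D))
    (Y : Ω → Fin m → ℝ) (hY : ∀ ω, Y ω = (A ω).mulVec (toReal (X ω)))
    (Xt : Ω → Fin n → ℝ)
    (hXt : ∀ᵐ ω ∂μ, IsCSPSolution C.codebook (A ω) (Y ω) (Xt ω)) :
    μ.real {ω | (2 + √((n : ℝ) / (m : ℝ))) * D ^ ((1 / 2 : ℝ) * (1 - (1 + δ) / η)) ≤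
        (1 / √(n : ℝ)) * l2norm (toReal (X ω) - Xt ω)} ≤
      ε + (2 : ℝ) ^ (-(1 / 2 : ℝ) * n * R * α) + Real.exp (-((m : ℝ) / 2)) := by
  have hn' : (0 : ℝ) < n := by exact_mod_cast hn
  simp only [hY] at hXt
  set θ : ℝ := (1 + δ) / η with hθ
  -- `K n D` is the square of the error threshold, without its summand `√(n / m)`.
  set K : ℝ := (2 * D ^ (-(θ / 2))) ^ 2 with hK
  have hK0 : 0 < K := by positivity
  have hsqrtK : 2 / √K = D ^ (θ / 2) := by
    rw [hK, Real.sqrt_sq (by positivity), Real.rpow_neg hD0.le]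
    field_simp
  have hKD : (√n * (2 * D ^ ((1 / 2 : ℝ) * (1 - θ)))) ^ 2 = K * (n * D) := by
    have : D ^ ((1 / 2 : ℝ) * (1 - θ)) = D ^ (-(θ / 2)) * √D := by
      rw [Real.sqrt_eq_rpow, ← Real.rpow_add hD0]
      congr 1
      ring
    rw [this, hK, mul_pow, mul_pow, mul_pow, mul_pow, Real.sq_sqrt hn'.le, Real.sq_sqrt hD0.le]
    ring
  calc _ ≤ μ.real {ω | K * (n * D) ≤ l2norm (toReal (X ω) - Xt ω) ^ 2} := by
        refine measureReal_mono fun ω hω => ?_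
        rw [Set.mem_ofPred_eq] at hω ⊢
        rw [← hKD]
        refine pow_le_pow_left₀ (by positivity) ?_ 2
        rw [one_div_mul_eq_div (√(n : ℝ)), le_div_iff₀' (Real.sqrt_pos.2 hn')] at hω
        refine le_trans ?_ hω
        gcongr
        exact le_add_of_nonneg_right (Real.sqrt_nonneg _)
    _ ≤ ε + (2 : ℝ) ^ ((n : ℝ) * R) * (2 / √K) ^ m :=
        measureReal_csp_error_le hn hX hA hXA hD0 hC hXt hK0
    _ ≤ ε + (2 : ℝ) ^ (-(1 / 2 : ℝ) * n * R * α) := by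
        rw [hsqrtK]
        gcongr
        exact rpow_mul_rpow_pow_le hm hn hD0 hD1 hα hη hδ hmn
    _ ≤ _ := le_add_of_nonneg_right (Real.exp_pos _).le
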